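/- **Setting.** Let $\Gamma$ be a finite metric space of sites, site $i$ carrying a finite-dimensional Hilbert space, and let $H=\sum_{\{i,j\}}h_{ij}$ be a Hamiltonian with bounded short-range two-body interactions (on-site terms $h_{ii}$ allowed): each $h_{ij}$ is Hermitian, acts on the sites $i,j$, satisfies $\|h_{ij}\|\le J$, vanishes if $d(i,j)>\ell$, and every site has at most $D$ other sites $j$ with $h_{ij}\neq 0$. The distance $d(\mathcal X,\mathcal Y)$ of two sets of sites is the shortest distance between a site of one and a site of the other. A state is a (fully) product state with respect to disjoint regions $\mathcal X_1,\dots,\mathcal X_n\subset\Gamma$ if it is a normalized tensor product of one vector $|\psi_{\mathcal X_k}\rangle$ for each region and one vector for each single site outside the regions. Observables are Hermitian with $\|A\|\le 1$, and $\langle\cdot\rangle_t$ is the expectation in the state $e^{-itH}|\psi\rangle$. The $n$-partite connected correlator (Ursell function) is $$u_n(A_1,\dots,A_n)=\sum_P(-1)^{|P|-1}(|P|-1)!\prod_{p\in P}\Big\langle\prod_{j\in p}A_j\Big\rangle_t ,$$ the sum being over all partitions $P$ of $\{1,\dots,n\}$. We say that the system obeys the bipartite Lieb–Robinson bound with velocity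 $v_{\mathrm{LR}}$ and constant $C_2$ if for all disjoint non-empty $\mathcal X,\mathcal Y\subset\Gamma$, all initial product states with respect to $\mathcal X,\mathcal Y$, all observables $A,B$ supported on $\mathcal X,\mathcal Y$ and all $t\ge0$, $$|\langle AB\rangle_t-\langle A\rangle_t\langle B\rangle_t|\le C_2\exp(v_{\mathrm{LR}}t-d(\mathcal X,\mathcal Y)).$$ Here $C_2=C_2(|\mathcal X|+|\mathcal Y|)$ may depend on the number of sites in the two regions (and may be a constant function). **Theorem 1.** Fix $\ell$, $J$, $D$. (i) There are $C>0$ and $v_{\mathrm{LR}}>0$, depending only on $\ell,J,D$, such that every system as above obeys the bipartite Lieb–Robinson bound with velocity $v_{\mathrm{LR}}$ and constant $C_2(m)=Cm$. (ii) Let a system as above obey the bipartite Lieb–Robinson bound with some velocity $v_{\mathrm{LR}}$ and constant $C_2$. Let $n\ge2$, let $\mathcal X_1,\dots,\mathcal X_n\subset\Gamma$ be non-empty and pairwise disjoint, let the initial state be a product state with respect to them, and let $A_k$ be an observable supported on $\mathcal X_k$. Then for all $t\ge 0$ $$|u_n(A_1,\dots,A_n)|\le C_n\exp(v_{\mathrm{LR}}t-R),\qquad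 C_n=\frac{n^n}{4}C_2,$$ where $C_2$ is taken at the total number $\sum_k|\mathcal X_k|$ of sites, and $$R=\max_{\emptyset\ne I\subsetneq\{1,\dots,n\}} d\Big(\bigcup_{k\in I}\mathcal X_k,\ \bigcup_{k\notin I}\mathcal X_k\Big).$$ -/

import Mathlib

open scoped Matrix.Norms.L2Operator

noncomputable section

namespace LiebRobinson

variable {Γ : Type} [Fintype Γ] [DecidableEq Γ]

/-- Basis configurations of a finite quantum system with site set `Γ`,
where site `i` carries the Hilbert space `ℂ ^ (q i)`. -/
abbrev Config (q : Γ → ℕ) : Type := (i : Γ) → Fin (q i)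

/-- Basis configurations of the sites in the region `X`. -/
abbrev RegionConfig (q : Γ → ℕ) (X : Finset Γ) : Type := (i : X) → Fin (q i)

/-- Operators on `⨂ i, ℂ ^ (q i)`, as matrices in the product basis. The norm is the operator norm
induced by the Hilbert space norm. -/
abbrev Op (q : Γ → ℕ) : Type := Matrix (Config q) (Config q) ℂ

/-- State vectors in `⨂ i, ℂ ^ (q i)`, in coordinates with respect to the product basis. -/
abbrev Ket (q : Γ → ℕ) : Type := Config q → ℂ

/-- The support of `A` lies in `X`: `A = a ⊗ 1` for an operator `a` on the region `X`. -/
def SupportedOn {q : Γ → ℕ} (X : Finset Γ) (A : Op q) : Prop :=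
  ∃ a : Matrix (RegionConfig q X) (RegionConfig q X) ℂ, ∀ s s' : Config q,
    A s s' = if ∀ i, i ∉ X → s i = s' i then a (fun i => s i) (fun i => s' i) else 0

/-- `A` is a normalized observable supported on the region `X`. -/
structure IsObservable {q : Γ → ℕ} (X : Finset Γ) (A : Op q) : Prop where
  hermitian : A.IsHermitian
  supported : SupportedOn X A
  norm_le_one : ‖A‖ ≤ 1

/-- The family `h` of terms, indexed by unordered pairs of sites (the diagonal pairs give on-site
terms), is a bounded short-range two-body interaction: the term of the pair `{i, j}` is a Hermitian
operator on the sites `i` and `j` of norm at most `J`, it vanishes if the distance of `i` and `j`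
exceeds `ℓ`, and every site interacts with at most `D` other sites. -/
structure IsShortRange [MetricSpace Γ] {q : Γ → ℕ} (ℓ J : ℝ) (D : ℕ) (h : Sym2 Γ → Op q) :
    Prop where
  hermitian : ∀ e, (h e).IsHermitian
  supported : ∀ i j, SupportedOn {i, j} (h s(i, j))
  norm_le : ∀ e, ‖h e‖ ≤ J
  range : ∀ i j, ℓ < dist i j → h s(i, j) = 0
  coordination : ∀ i, {j | j ≠ i ∧ h s(i, j) ≠ 0}.ncard ≤ D

/-- The Hamiltonian: the sum of all interaction terms. -/
def hamiltonian {q : Γ → ℕ} (h : Sym2 Γ → Op q) : Op q := ∑ e, h e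

/-- The state `exp(-i t H) ψ` at time `t`. -/
def evolve {q : Γ → ℕ} (H : Op q) (t : ℝ) (ψ : Ket q) : Ket q :=
  Matrix.mulVec (NormedSpace.exp ((-(Complex.I * (t : ℂ))) • H)) ψ

/-- The expectation value `⟨ψ| A |ψ⟩`. -/
def expval {q : Γ → ℕ} (ψ : Ket q) (A : Op q) : ℂ := star ψ ⬝ᵥ A.mulVec ψ

/-- `ψ` is a normalized fully product state with respect to the regions `X k`:
a tensor product of one vector for each region `X k` (with arbitrary entanglement inside it)
and one vector for every single site outside all the regions. -/
def IsProductState {q : Γ → ℕ} {n : ℕ} (X : Fin n → Finset Γ) (ψ : Ket q) : Prop :=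
  star ψ ⬝ᵥ ψ = 1 ∧
  ∃ (φ : (k : Fin n) → RegionConfig q (X k) → ℂ) (χ : (i : Γ) → Fin (q i) → ℂ),
    ∀ s : Config q,
      ψ s = (∏ k, φ k (fun i => s i)) * ∏ i ∈ (Finset.univ.biUnion X)ᶜ, χ i (s i)

/-- The bipartite connected correlator `⟨AB⟩ - ⟨A⟩⟨B⟩`. -/
def connected {q : Γ → ℕ} (ψ : Ket q) (A B : Op q) : ℂ :=
  expval ψ (A * B) - expval ψ A * expval ψ B

/-- The product of the `A j` with `j ∈ p`, in increasing order of `j`. The order plays no role for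
observables with disjoint supports, which commute. -/
def blockProd {q : Γ → ℕ} {n : ℕ} (A : Fin n → Op q) (p : Finset (Fin n)) : Op q :=
  ((p.sort (· ≤ ·)).map A).prod

/-- The `n`-partite connected correlator (Ursell function)
`∑_P (-1)^(|P| - 1) (|P| - 1)! ∏_{p ∈ P} ⟨∏_{j ∈ p} A_j⟩` over all partitions `P` of the index
set. -/
def ursell {q : Γ → ℕ} {n : ℕ} (ψ : Ket q) (A : Fin n → Op q) : ℂ :=
  ∑ P : Finpartition (Finset.univ : Finset (Fin n)),
    (-1 : ℂ) ^ (P.parts.card - 1) * ((P.parts.card - 1).factorial : ℂ) *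
      ∏ p ∈ P.parts, expval ψ (blockProd A p)

/-- The shortest distance between a site of `X` and a site of `Y`. -/
def setDist [MetricSpace Γ] (X Y : Finset Γ) : ℝ :=
  sInf {r | ∃ x ∈ X, ∃ y ∈ Y, r = dist x y}

/-- The largest distance, over all bipartitions of the family of regions `X k` into two nonempty
subfamilies, between the two parts. -/
def criticalDist [MetricSpace Γ] {n : ℕ} (X : Fin n → Finset Γ) : ℝ :=
  sSup {r | ∃ I : Finset (Fin n), I.Nonempty ∧ Iᶜ.Nonempty ∧
    r = setDist (I.biUnion X) (Iᶜ.biUnion X)}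

/-- The system with interaction `h` obeys the bipartite Lieb-Robinson bound
`|⟨AB⟩ - ⟨A⟩⟨B⟩| ≤ C₂ exp (v t - r)` with velocity `v` and constant `C₂`, for all pairs of disjoint
regions at distance `r`, all normalized observables on them and all initial product states. The
constant may depend on the number of sites in the two regions, as it does in the usual bounds; a
constant function `C₂` gives the bound with the same constant for all regions. -/
def BipartiteBound [MetricSpace Γ] {q : Γ → ℕ} (h : Sym2 Γ → Op q) (C₂ : ℕ → ℝ) (v : ℝ) : Prop :=
  ∀ X Y : Finset Γ, X.Nonempty → Y.Nonempty → Disjoint X Y →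
    ∀ ψ : Ket q, IsProductState ![X, Y] ψ →
      ∀ A B : Op q, IsObservable X A → IsObservable Y B →
        ∀ t : ℝ, 0 ≤ t →
          ‖connected (evolve (hamiltonian h) t ψ) A B‖ ≤
            C₂ (X.card + Y.card) * Real.exp (v * t - setDist X Y)

end LiebRobinson

end

/-!
The two parts of the theorem have independent proofs.

*Bipartite bound.* The Heisenberg evolution of an observable `A` on `X` is compared with the
evolution generated by the terms inside a neighbourhood `S` of `X` only. Let `h` be the sum of the
terms acting on `X`, which belong to both Hamiltonians `H` and `H'`. Since `A` commutes with
`H - h` and `H' - h`, only the unitaries `exp(itH) exp(-it(H - h))` and `exp(itH') exp(-it(H' - h))`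
matter, and the time derivative of their quotient has the norm of the difference of the two
evolutions of `h` (`norm_heisenberg_sub_le`). As `h` is a sum of at most `|X| (D + 1)` terms acting
on pairs of sites near `X`, this closes an induction on the number of interaction ranges between
`X` and the complement of `S`; an exponential in `t` with a large enough velocity reproduces itself
in each step (`IsShortRange.norm_heisenberg_sub_local_le`). No commutator bound is needed.
If `S` is the neighbourhood of `X` of half the distance to `Y`, then the observable on `X` evolved
inside `S` and the one on `Y` evolved inside the complement of `S` are exactly uncorrelated in a
product state (`expval_mul_of_split`).

*Multipartite bound.* Take a bipartition `I`, `Iᶜ` of the indices that realizes the critical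
distance. The bipartite bound says that all moments `m p = ⟨∏_{j ∈ p} A_j⟩` approximately equal
`m (p ∩ I) * m (p ∩ Iᶜ)`. For moments which factorize exactly, the Ursell function vanishes
(`cumulant_eq_zero`): it is the linear coefficient of the polynomial in `N` that sums the product of
the moments over the colour classes of all colourings of the indices with `N` colours, and for
factorizing moments this polynomial is a product of two polynomials without constant term.
Replacing the moments in the term of a partition `P` costs at most one error for each pair of
`i ∈ I` and `j ∈ Iᶜ` in a common block, with weight `(|P| - 1)!`. Now `n (|P| - 1)!` is at most
the number of colourings with `n` colours that have the colour classes `P`, and `n ^ (n - 1)`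
colourings give two chosen indices the same colour. So each pair contributes at most `n ^ (n - 2)`,
and there are `|I| |Iᶜ| ≤ n ^ 2 / 4` pairs (`sum_factorial_crossing_le`), which is the constant
`n ^ n / 4`.
-/

namespace LiebRobinson

/-! ### Partitions into colour classes -/

section Colouring

variable {α β : Type*} [Fintype α] [DecidableEq α]

lemma parts_eq_image_part (P : Finpartition (Finset.univ : Finset α)) :
    P.parts = Finset.univ.image P.part := by
  ext p
  simp only [Finset.mem_image, Finset.mem_univ, true_and]
  constructor
  · intro hp
    obtain ⟨a, ha⟩ := P.nonempty_of_mem_parts hp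
    exact ⟨a, P.part_eq_of_mem hp ha⟩
  · rintro ⟨a, rfl⟩
    simp

variable [DecidableEq β]

/-- The partition of `α` into the nonempty colour classes of a colouring `c : α → β`. -/
def colourPartition (c : α → β) : Finpartition (Finset.univ : Finset α) :=
  Finpartition.ofSetoid (Setoid.ker c)

lemma mem_part_colourPartition (c : α → β) (a b : α) :
    b ∈ (colourPartition c).part a ↔ c a = c b := by
  rw [colourPartition, Finpartition.mem_part_ofSetoid_iff_rel]; rfl

lemma parts_colourPartition (c : α → β) :
    (colourPartition c).parts =
      Finset.univ.image fun a => Finset.univ.filter fun b => c a = c b := by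
  ext p
  simp only [colourPartition, Finpartition.ofSetoid, Finpartition.ofSetSetoid]
  simp

lemma colourPartition_eq_iff (c : α → β) (P : Finpartition (Finset.univ : Finset α)) :
    colourPartition c = P ↔ ∀ a b, c a = c b ↔ b ∈ P.part a := by
  constructor
  · rintro rfl a b
    exact (mem_part_colourPartition c a b).symm
  · intro h
    apply Finpartition.ext
    rw [parts_eq_image_part, parts_eq_image_part]
    congr 1
    ext a b
    rw [mem_part_colourPartition, h]

variable [Fintype β]

/-- The colourings with a given partition into colour classes are the injections of the blocks into
the set of colours. -/
lemma card_colourPartition_eq (P : Finpartition (Finset.univ : Finset α)) :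
    (Finset.univ.filter fun c : α → β => colourPartition c = P).card =
      (Fintype.card β).descFactorial P.parts.card := by
  have hcard : Fintype.card (P.parts ↪ β) = (Fintype.card β).descFactorial P.parts.card := by
    rw [Fintype.card_embedding_eq, Fintype.card_coe]
  rw [← hcard, ← Finset.card_univ]
  symm
  refine Finset.card_bij
    (fun (e : P.parts ↪ β) _ (a : α) => e ⟨P.part a, by simp⟩) ?_ ?_ ?_
  · intro e _
    simp only [Finset.mem_filter, Finset.mem_univ, true_and]
    rw [colourPartition_eq_iff]
    intro a b
    rw [e.injective.eq_iff, Subtype.mk.injEq, Finpartition.mem_part_iff_part_eq_part _ (by simp)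
      (by simp), eq_comm]
  · intro e _ e' _ h
    ext ⟨p, hp⟩
    obtain ⟨a, ha⟩ := P.nonempty_of_mem_parts hp
    have := congrFun h a
    simpa only [P.part_eq_of_mem hp ha] using this
  · intro c hc
    simp only [Finset.mem_filter, Finset.mem_univ, true_and] at hc
    rw [colourPartition_eq_iff] at hc
    choose r hr using fun p : P.parts => P.nonempty_of_mem_parts p.2
    refine ⟨⟨fun p => c (r p), fun p p' h => ?_⟩, Finset.mem_univ _, ?_⟩
    · have h1 := (hc _ _).1 h
      rw [P.part_eq_of_mem p.2 (hr p)] at h1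
      exact Subtype.ext (P.eq_of_mem_parts p.2 p'.2 h1 (hr p'))
    · funext a
      have h1 := hr ⟨P.part a, by simp⟩
      exact ((hc _ _).2 h1).symm

/-- Summing a function of the colour classes over all colourings. -/
lemma sum_colourPartition {R : Type*} [CommSemiring R]
    (F : Finpartition (Finset.univ : Finset α) → R) :
    ∑ c : α → β, F (colourPartition c) =
      ∑ P, ((Fintype.card β).descFactorial P.parts.card : R) * F P := by
  rw [← Finset.sum_fiberwise Finset.univ (fun c : α → β => colourPartition c)]
  refine Finset.sum_congr rfl fun P _ => ?_
  rw [← card_colourPartition_eq P, ← nsmul_eq_mul, ← Finset.sum_const]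
  refine Finset.sum_congr rfl fun c hc => ?_
  rw [(Finset.mem_filter.1 hc).2]

lemma prod_parts_colourPartition {R : Type*} [CommSemiring R] (m : Finset α → R) (hm : m ∅ = 1)
    (c : α → β) :
    ∏ p ∈ (colourPartition c).parts, m p = ∏ b, m (Finset.univ.filter fun a => c a = b) := by
  have himg : (colourPartition c).parts =
      (Finset.univ.image c).image fun b => Finset.univ.filter fun a => c a = b := by
    rw [parts_colourPartition, Finset.image_image]
    refine Finset.image_congr fun a _ => ?_
    ext b
    simp [eq_comm]
  rw [himg, Finset.prod_image]
  · refine Finset.prod_subset (Finset.subset_univ _) fun b _ hb => ?_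
    rw [← hm]
    congr 1
    ext a
    simp only [Finset.mem_filter, Finset.mem_univ, true_and, Finset.notMem_empty, iff_false]
    rintro rfl
    exact hb (Finset.mem_image_of_mem c (Finset.mem_univ a))
  · intro b hb b' _ h
    obtain ⟨a, -, rfl⟩ := Finset.mem_image.1 hb
    have : a ∈ Finset.univ.filter fun x => c x = c a := by simp
    have h' : Finset.univ.filter (fun x => c x = c a) = Finset.univ.filter fun x => c x = b' := h
    rw [h'] at this
    simpa using this

end Colouring

/-! ### Vanishing of joint cumulants -/

section Cumulant

open Polynomial

variable {α : Type*} [Fintype α] [DecidableEq α]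

/-- The polynomial in `N` whose value at a natural number `N` is the sum over all colourings of `α`
with `N` colours of the product of `m` over the colour classes. Its linear coefficient is the joint
cumulant of the "moments" `m`. -/
noncomputable def colourPolynomial (m : Finset α → ℂ) : ℂ[X] :=
  ∑ P : Finpartition (Finset.univ : Finset α),
    C (∏ p ∈ P.parts, m p) * descPochhammer ℂ P.parts.card

lemma eval_colourPolynomial (m : Finset α → ℂ) (hm : m ∅ = 1) (N : ℕ) :
    (colourPolynomial m).eval (N : ℂ) =
      ∑ c : α → Fin N, ∏ b, m (Finset.univ.filter fun a => c a = b) := by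
  have h := sum_colourPartition (β := Fin N)
    fun P : Finpartition (Finset.univ : Finset α) => ∏ p ∈ P.parts, m p
  simp only [prod_parts_colourPartition m hm] at h
  rw [h, colourPolynomial, eval_finsetSum]
  refine Finset.sum_congr rfl fun P _ => ?_
  rw [eval_mul, eval_C, descPochhammer_eval_eq_descFactorial, Fintype.card_fin, mul_comm]

lemma coeff_zero_colourPolynomial [Nonempty α] (m : Finset α → ℂ) :
    (colourPolynomial m).coeff 0 = 0 := by
  rw [coeff_zero_eq_eval_zero, colourPolynomial, eval_finsetSum]
  refine Finset.sum_eq_zero fun P _ => ?_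
  have : P.parts.card ≠ 0 :=
    Finset.card_ne_zero.2 (P.parts_nonempty (Finset.univ_nonempty.ne_empty))
  rw [eval_mul, descPochhammer_ne_zero_eval_zero _ this, mul_zero]

lemma coeff_one_descPochhammer (k : ℕ) :
    (descPochhammer ℂ (k + 1)).coeff 1 = (-1) ^ k * (k.factorial : ℂ) := by
  rw [descPochhammer_succ_left, coeff_X_mul, coeff_zero_eq_eval_zero, eval_comp]
  simp only [eval_sub, eval_X, eval_one, zero_sub]
  induction k with
  | zero => simp
  | succ k ih =>
    rw [descPochhammer_succ_eval, ih, Nat.factorial_succ]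
    push_cast
    ring

lemma coeff_one_colourPolynomial [Nonempty α] (m : Finset α → ℂ) :
    (colourPolynomial m).coeff 1 = ∑ P : Finpartition (Finset.univ : Finset α),
      (-1 : ℂ) ^ (P.parts.card - 1) * ((P.parts.card - 1).factorial : ℂ) * ∏ p ∈ P.parts, m p := by
  rw [colourPolynomial, finsetSum_coeff]
  refine Finset.sum_congr rfl fun P _ => ?_
  have : 0 < P.parts.card :=
    Finset.card_pos.2 (P.parts_nonempty (Finset.univ_nonempty.ne_empty))
  obtain ⟨k, hk⟩ := Nat.exists_eq_succ_of_ne_zero this.ne'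
  rw [coeff_C_mul, hk, Nat.succ_eq_add_one, coeff_one_descPochhammer, Nat.add_sub_cancel, mul_comm]

/-- If the moments factorize along the bipartition `I`, `Iᶜ`, then colourings of the two parts are
independent of each other. -/
lemma colourPolynomial_eq_mul (I : Finset α) (f m : Finset α → ℂ) (hm : m ∅ = 1)
    (hf : ∀ s, f s = m (s ∩ I) * m (s ∩ Iᶜ)) :
    colourPolynomial f =
      colourPolynomial (fun s : Finset {a // a ∈ I} => m (s.map (Function.Embedding.subtype _))) *
      colourPolynomial
        (fun s : Finset {a // ¬ a ∈ I} => m (s.map (Function.Embedding.subtype _))) := by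
  refine Polynomial.eq_of_infinite_eval_eq _ _
    ((Set.infinite_range_of_injective (Nat.cast_injective (R := ℂ))).mono ?_)
  rintro _ ⟨N, rfl⟩
  show eval _ _ = eval _ _
  rw [eval_mul, eval_colourPolynomial _ (by simp [hf, hm]), eval_colourPolynomial _ (by simp [hm]),
    eval_colourPolynomial _ (by simp [hm]), Finset.sum_mul_sum, ← Fintype.sum_prod_type',
    ← (Equiv.piEquivPiSubtypeProd (fun a => a ∈ I) fun _ => Fin N).sum_comp]
  refine Finset.sum_congr rfl fun c _ => ?_
  rw [← Finset.prod_mul_distrib]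
  refine Finset.prod_congr rfl fun b _ => ?_
  rw [hf]
  congr 2
  · ext a
    simp [and_comm]
  · ext a
    simp [and_comm]

/-- The joint cumulant vanishes if the moments factorize along a bipartition. -/
lemma cumulant_eq_zero (I : Finset α) (hI : I.Nonempty) (hI' : Iᶜ.Nonempty) (m : Finset α → ℂ)
    (hm : m ∅ = 1) :
    ∑ P : Finpartition (Finset.univ : Finset α),
      (-1 : ℂ) ^ (P.parts.card - 1) * ((P.parts.card - 1).factorial : ℂ) *
        ∏ p ∈ P.parts, m (p ∩ I) * m (p ∩ Iᶜ) = 0 := by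
  obtain ⟨i, hi⟩ := hI
  obtain ⟨j, hj⟩ := hI'
  have : Nonempty α := ⟨i⟩
  have : Nonempty {a // a ∈ I} := ⟨⟨i, hi⟩⟩
  have : Nonempty {a // ¬ a ∈ I} := ⟨⟨j, by simpa using hj⟩⟩
  rw [← coeff_one_colourPolynomial (fun s => m (s ∩ I) * m (s ∩ Iᶜ)),
    colourPolynomial_eq_mul I _ m hm fun _ => rfl, mul_coeff_one, coeff_zero_colourPolynomial,
    coeff_zero_colourPolynomial]
  simp

end Cumulant

/-! ### The size of joint cumulants -/

section Counting

variable {α : Type*} [Fintype α] [DecidableEq α]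

lemma card_colourings_eq_le {β : Type*} [Fintype β] [DecidableEq β] {i j : α} (hij : i ≠ j) :
    (Finset.univ.filter fun c : α → β => c i = c j).card ≤
      Fintype.card β ^ (Fintype.card α - 1) := by
  have h : Fintype.card ({a // a ≠ j} → β) = Fintype.card β ^ (Fintype.card α - 1) := by
    rw [Fintype.card_fun, Fintype.card_subtype_compl, Fintype.card_subtype_eq]
  rw [← h, ← Finset.card_univ]
  refine Finset.card_le_card_of_injOn (fun c a => c a) (fun _ _ => Finset.mem_univ _) ?_
  intro c hc c' hc' h
  simp only [Finset.coe_filter, Finset.mem_univ, true_and, Set.mem_ofPred_eq] at hc hc'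
  funext a
  by_cases ha : a = j
  · rw [ha, ← hc, ← hc']
    exact congrFun h ⟨i, hij⟩
  · exact congrFun h ⟨a, ha⟩

lemma mul_factorial_le_descFactorial {n k : ℕ} (hk : 0 < k) (hkn : k ≤ n) :
    n * (k - 1).factorial ≤ n.descFactorial k := by
  obtain ⟨k, rfl⟩ := Nat.exists_eq_succ_of_ne_zero hk.ne'
  obtain ⟨n, rfl⟩ := Nat.exists_eq_succ_of_ne_zero (hk.trans_le hkn).ne'
  simp only [Nat.succ_eq_add_one, Nat.add_sub_cancel, Nat.succ_descFactorial_succ]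
  refine Nat.mul_le_mul_left _ ?_
  rw [← Nat.descFactorial_self]
  exact Nat.descFactorial_le _ (by omega)

/-- The partitions with `i` and `j` in a common block, counted with the weights of the Ursell
function, are bounded by the colourings that give `i` and `j` the same colour. -/
lemma sum_factorial_same_block_le {i j : α} (hij : i ≠ j) :
    Fintype.card α * ∑ P : Finpartition (Finset.univ : Finset α),
      (P.parts.card - 1).factorial * (if j ∈ P.part i then 1 else 0) ≤
      Fintype.card α ^ (Fintype.card α - 1) := by
  refine le_trans ?_ (card_colourings_eq_le (β := α) hij)
  have h := sum_colourPartition (β := α)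
    fun P : Finpartition (Finset.univ : Finset α) => if j ∈ P.part i then 1 else 0
  simp only [mem_part_colourPartition] at h
  rw [Finset.card_filter, h, Finset.mul_sum]
  refine Finset.sum_le_sum fun P _ => ?_
  rw [← mul_assoc]
  refine Nat.mul_le_mul_right _ ?_
  have : Nonempty α := ⟨i⟩
  exact mul_factorial_le_descFactorial
    (Finset.card_pos.2 (P.parts_nonempty (Finset.univ_nonempty.ne_empty))) P.card_parts_le_card

/-- The number of pairs of an element of `I` and an element of `Iᶜ` that lie in a common block,
summed over all partitions with the weights of the Ursell function. -/
lemma sum_factorial_crossing_le (I : Finset α) (hα : 2 ≤ Fintype.card α) :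
    ∑ P : Finpartition (Finset.univ : Finset α), ((P.parts.card - 1).factorial : ℝ) *
      ∑ i ∈ I, ∑ j ∈ Iᶜ, (if j ∈ P.part i then (1 : ℝ) else 0) ≤
      (Fintype.card α : ℝ) ^ Fintype.card α / 4 := by
  set n := Fintype.card α with hn
  have hn0 : (0 : ℝ) < n := by exact_mod_cast (by omega : 0 < n)
  have hpair : ∀ i ∈ I, ∀ j ∈ Iᶜ, ∑ P : Finpartition (Finset.univ : Finset α),
      ((P.parts.card - 1).factorial : ℝ) * (if j ∈ P.part i then (1 : ℝ) else 0) ≤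
        (n : ℝ) ^ (n - 2) := by
    intro i hi j hj
    have hij : i ≠ j := by
      rintro rfl
      exact (Finset.mem_compl.1 hj) hi
    have h := sum_factorial_same_block_le hij
    rw [← hn, show n - 1 = (n - 2) + 1 by omega, pow_succ, mul_comm] at h
    have h' := Nat.le_of_mul_le_mul_right h (by omega)
    have h2 := (Nat.cast_le (α := ℝ)).2 h'
    push_cast at h2
    exact h2
  calc _ = ∑ i ∈ I, ∑ j ∈ Iᶜ, ∑ P : Finpartition (Finset.univ : Finset α),
      ((P.parts.card - 1).factorial : ℝ) * (if j ∈ P.part i then (1 : ℝ) else 0) := by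
        simp only [Finset.mul_sum]
        rw [Finset.sum_comm]
        refine Finset.sum_congr rfl fun i _ => ?_
        rw [Finset.sum_comm]
    _ ≤ ∑ i ∈ I, ∑ j ∈ Iᶜ, (n : ℝ) ^ (n - 2) :=
        Finset.sum_le_sum fun i hi => Finset.sum_le_sum fun j hj => hpair i hi j hj
    _ = (I.card : ℝ) * (Iᶜ.card : ℝ) * (n : ℝ) ^ (n - 2) := by
        simp only [Finset.sum_const, nsmul_eq_mul]
        ring
    _ ≤ (n : ℝ) ^ 2 / 4 * (n : ℝ) ^ (n - 2) := by
        have hc : (I.card : ℝ) + (Iᶜ.card : ℝ) = n := by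
          exact_mod_cast Finset.card_add_card_compl I
        gcongr
        rw [← hc]
        nlinarith [sq_nonneg ((I.card : ℝ) - (Iᶜ.card : ℝ))]
    _ = (n : ℝ) ^ n / 4 := by
        have : (n : ℝ) ^ n = (n : ℝ) ^ 2 * (n : ℝ) ^ (n - 2) := by
          rw [← pow_add]
          congr 1
          omega
        rw [this]
        ring

lemma norm_prod_sub_prod_le_sum {ι : Type*} [DecidableEq ι] (s : Finset ι) (f g : ι → ℂ)
    (hf : ∀ i ∈ s, ‖f i‖ ≤ 1) (hg : ∀ i ∈ s, ‖g i‖ ≤ 1) :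
    ‖∏ i ∈ s, f i - ∏ i ∈ s, g i‖ ≤ ∑ i ∈ s, ‖f i - g i‖ := by
  induction s using Finset.induction_on with
  | empty => simp
  | insert a s ha ih =>
    rw [Finset.prod_insert ha, Finset.prod_insert ha, Finset.sum_insert ha]
    have ih' := ih (fun i hi => hf i (Finset.mem_insert_of_mem hi))
      fun i hi => hg i (Finset.mem_insert_of_mem hi)
    have hP : ‖∏ i ∈ s, f i‖ ≤ 1 := by
      rw [norm_prod]
      exact Finset.prod_le_one (fun _ _ => norm_nonneg _)
        fun i hi => hf i (Finset.mem_insert_of_mem hi)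
    calc ‖f a * ∏ i ∈ s, f i - g a * ∏ i ∈ s, g i‖
        = ‖(f a - g a) * ∏ i ∈ s, f i + g a * (∏ i ∈ s, f i - ∏ i ∈ s, g i)‖ := by
          congr 1
          ring
      _ ≤ ‖f a - g a‖ * ‖∏ i ∈ s, f i‖ + ‖g a‖ * ‖∏ i ∈ s, f i - ∏ i ∈ s, g i‖ := by
          refine (norm_add_le _ _).trans ?_
          rw [norm_mul, norm_mul]
      _ ≤ ‖f a - g a‖ * 1 + 1 * ∑ i ∈ s, ‖f i - g i‖ := by
          gcongr
          exact hg a (Finset.mem_insert_self _ _)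
      _ = _ := by ring

/-- A joint cumulant is small as soon as the moments approximately factorize along one bipartition
of the index set. -/
lemma norm_cumulant_le (I : Finset α) (hI : I.Nonempty) (hI' : Iᶜ.Nonempty) (m : Finset α → ℂ)
    (hm : m ∅ = 1) (hm1 : ∀ s, ‖m s‖ ≤ 1) (ε : ℝ) (hε : 0 ≤ ε)
    (hmε : ∀ s, ‖m s - m (s ∩ I) * m (s ∩ Iᶜ)‖ ≤ ε) :
    ‖∑ P : Finpartition (Finset.univ : Finset α),
      (-1 : ℂ) ^ (P.parts.card - 1) * ((P.parts.card - 1).factorial : ℂ) *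
        ∏ p ∈ P.parts, m p‖ ≤ (Fintype.card α : ℝ) ^ Fintype.card α / 4 * ε := by
  have hα : 2 ≤ Fintype.card α := by
    have h1 := Finset.card_add_card_compl I
    have h2 := Finset.card_pos.2 hI
    have h3 := Finset.card_pos.2 hI'
    omega
  rw [← sub_zero (∑ P : Finpartition (Finset.univ : Finset α), _),
    ← cumulant_eq_zero I hI hI' m hm, ← Finset.sum_sub_distrib]
  refine (norm_sum_le _ _).trans ?_
  refine le_trans ?_ (mul_le_mul_of_nonneg_right (sum_factorial_crossing_le I hα) hε)
  rw [Finset.sum_mul]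
  refine Finset.sum_le_sum fun P _ => ?_
  rw [← mul_sub, norm_mul, norm_mul, norm_pow, norm_neg, norm_one, one_pow, one_mul,
    Complex.norm_natCast, mul_assoc]
  refine mul_le_mul_of_nonneg_left ?_ (Nat.cast_nonneg _)
  refine (norm_prod_sub_prod_le_sum _ _ _ (fun p _ => hm1 p) fun p _ => ?_).trans ?_
  · rw [norm_mul]
    exact mul_le_one₀ (hm1 _) (norm_nonneg _) (hm1 _)
  -- A block contributes only if it contains an element of `I` and an element of `Iᶜ`.
  have hblock : ∀ p ∈ P.parts, ‖m p - m (p ∩ I) * m (p ∩ Iᶜ)‖ ≤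
      ∑ i ∈ I, ∑ j ∈ Iᶜ, (if i ∈ p ∧ j ∈ p then (1 : ℝ) else 0) * ε := by
    intro p _
    have hnn : ∀ i ∈ I, 0 ≤ ∑ j ∈ Iᶜ, (if i ∈ p ∧ j ∈ p then (1 : ℝ) else 0) * ε :=
      fun i _ => Finset.sum_nonneg fun j _ => by positivity
    rcases (p ∩ I).eq_empty_or_nonempty with h | ⟨i, hi⟩
    · have h' : p ∩ Iᶜ = p := by
        rw [Finset.inter_eq_left]
        intro a ha
        rw [Finset.mem_compl]
        intro haI
        have : a ∈ p ∩ I := Finset.mem_inter.2 ⟨ha, haI⟩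
        simp [h] at this
      rw [h, h', hm, one_mul, sub_self, norm_zero]
      exact Finset.sum_nonneg hnn
    rcases (p ∩ Iᶜ).eq_empty_or_nonempty with h | ⟨j, hj⟩
    · have h' : p ∩ I = p := by
        rw [Finset.inter_eq_left]
        intro a ha
        by_contra haI
        have : a ∈ p ∩ Iᶜ := Finset.mem_inter.2 ⟨ha, Finset.mem_compl.2 haI⟩
        simp [h] at this
      rw [h, h', hm, mul_one, sub_self, norm_zero]
      exact Finset.sum_nonneg hnn
    rw [Finset.mem_inter] at hi hj
    refine (hmε p).trans ?_
    refine le_trans ?_ (Finset.single_le_sum hnn hi.2)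
    refine le_trans ?_ (Finset.single_le_sum (fun j _ => by positivity) hj.2)
    simp [hi.1, hj.1]
  refine (Finset.sum_le_sum hblock).trans (le_of_eq ?_)
  rw [Finset.sum_comm, Finset.sum_mul]
  refine Finset.sum_congr rfl fun i _ => ?_
  rw [Finset.sum_comm, Finset.sum_mul]
  refine Finset.sum_congr rfl fun j _ => ?_
  rw [← Finset.sum_mul]
  congr 1
  rw [Finset.sum_eq_single_of_mem (P.part i) (by simp)]
  · simp
  · intro p hp hne
    rw [if_neg]
    rintro ⟨hip, -⟩
    exact hne (P.part_eq_of_mem hp hip).symm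

end Counting

/-! ### Comparison of Heisenberg evolutions -/

section Dynamics

variable {𝔸 : Type*} [CStarAlgebra 𝔸]

/-- The unitary `exp(i t H)`. -/
noncomputable def propagator (H : 𝔸) (t : ℝ) : 𝔸 := NormedSpace.exp (t • (Complex.I • H))

/-- The Heisenberg evolution `exp(i t H) A exp(-i t H)`. -/
noncomputable def heisenberg (H : 𝔸) (t : ℝ) (A : 𝔸) : 𝔸 := propagator H t * A * propagator H (-t)

lemma propagator_zero (H : 𝔸) : propagator H 0 = 1 := by
  simp [propagator, NormedSpace.exp_zero]

lemma propagator_mul_neg (H : 𝔸) (t : ℝ) : propagator H t * propagator H (-t) = 1 := by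
  let _ : NormedAlgebra ℚ 𝔸 := NormedAlgebra.restrictScalars ℚ ℂ 𝔸
  rw [propagator, propagator, neg_smul,
    ← NormedSpace.exp_add_of_commute (Commute.refl _).neg_right, add_neg_cancel,
    NormedSpace.exp_zero]

lemma propagator_neg_mul (H : 𝔸) (t : ℝ) : propagator H (-t) * propagator H t = 1 := by
  simpa using propagator_mul_neg H (-t)

lemma star_propagator {H : 𝔸} (hH : IsSelfAdjoint H) (t : ℝ) :
    star (propagator H t) = propagator H (-t) := by
  rw [propagator, propagator, NormedSpace.star_exp, star_smul, star_smul, hH.star_eq, star_trivial,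
    Complex.star_def, Complex.conj_I, neg_smul, neg_smul, smul_neg]

lemma propagator_mem_unitary {H : 𝔸} (hH : IsSelfAdjoint H) (t : ℝ) :
    propagator H t ∈ unitary 𝔸 := by
  rw [Unitary.mem_iff, star_propagator hH]
  exact ⟨propagator_neg_mul H t, propagator_mul_neg H t⟩

lemma commute_propagator_right {A H : 𝔸} (h : Commute A H) (t : ℝ) :
    Commute A (propagator H t) := by
  let _ : NormedAlgebra ℚ 𝔸 := NormedAlgebra.restrictScalars ℚ ℂ 𝔸
  exact ((h.smul_right _).smul_right _).exp_right

lemma hasDerivAt_propagator (H : 𝔸) (t : ℝ) :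
    HasDerivAt (propagator H) (propagator H t * (Complex.I • H)) t :=
  hasDerivAt_exp_smul_const _ _

lemma hasDerivAt_propagator_neg (H : 𝔸) (t : ℝ) :
    HasDerivAt (fun s => propagator H (-s)) (-((Complex.I • H) * propagator H (-t))) t := by
  have h := (hasDerivAt_exp_smul_const' (Complex.I • H) (-t)).scomp t (hasDerivAt_neg t)
  simpa [propagator, Function.comp_def] using h

lemma heisenberg_mul (H : 𝔸) (t : ℝ) (A B : 𝔸) :
    heisenberg H t (A * B) = heisenberg H t A * heisenberg H t B := by
  calc heisenberg H t (A * B)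
      = propagator H t * A * 1 * (B * propagator H (-t)) := by simp only [heisenberg]; noncomm_ring
    _ = propagator H t * A * (propagator H (-t) * propagator H t) * (B * propagator H (-t)) := by
        rw [propagator_neg_mul]
    _ = _ := by simp only [heisenberg]; noncomm_ring

lemma heisenberg_sum {ι : Type*} (s : Finset ι) (H : 𝔸) (t : ℝ) (A : ι → 𝔸) :
    heisenberg H t (∑ i ∈ s, A i) = ∑ i ∈ s, heisenberg H t (A i) := by
  simp only [heisenberg, Finset.mul_sum, Finset.sum_mul]

lemma norm_heisenberg {H : 𝔸} (hH : IsSelfAdjoint H) (t : ℝ) (A : 𝔸) :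
    ‖heisenberg H t A‖ = ‖A‖ := by
  rw [heisenberg, CStarRing.norm_mul_mem_unitary _ (propagator_mem_unitary hH _),
    CStarRing.norm_mem_unitary_mul _ (propagator_mem_unitary hH _)]

/-- The derivative of `exp(i t (H' - h)) exp(-i t H') exp(i t H) exp(-i t (H - h))`. This operator
compares the propagators of `H` and `H'` in the interaction pictures that treat `h` as the
interaction. -/
lemma hasDerivAt_interaction (H H' h : 𝔸) (t : ℝ) :
    HasDerivAt (fun s => (propagator (H' - h) s * propagator H' (-s)) *
        (propagator H s * propagator (H - h) (-s)))
      ((propagator (H' - h) t * propagator H' (-t)) *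
        (Complex.I • (heisenberg H t h - heisenberg H' t h)) *
        (propagator H t * propagator (H - h) (-t))) t := by
  have h1 := (hasDerivAt_propagator (H' - h) t).mul (hasDerivAt_propagator_neg H' t)
  have h2 := (hasDerivAt_propagator H t).mul (hasDerivAt_propagator_neg (H - h) t)
  refine (h1.mul h2).congr_deriv ?_
  have e1 : propagator H' (-t) * heisenberg H' t h = h * propagator H' (-t) := by
    rw [heisenberg, mul_assoc, ← mul_assoc, propagator_neg_mul, one_mul]
  have e2 : heisenberg H t h * propagator H t = propagator H t * h := by
    rw [heisenberg, mul_assoc, propagator_neg_mul, mul_one]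
  calc _ = Complex.I • ((propagator (H' - h) t * propagator H' (-t)) *
        (propagator H t * h) * propagator (H - h) (-t) -
        propagator (H' - h) t * (h * propagator H' (-t)) *
          (propagator H t * propagator (H - h) (-t))) := by
        simp only [Pi.mul_apply]
        generalize propagator (H' - h) t = a, propagator H' (-t) = b, propagator H t = c,
          propagator (H - h) (-t) = d
        simp only [smul_mul_assoc, mul_smul_comm, smul_sub, mul_sub, sub_mul, mul_assoc, mul_neg,
          neg_mul, add_mul, mul_add]
        abel
    _ = _ := by
        rw [← e1, ← e2]
        simp only [smul_mul_assoc, mul_smul_comm, smul_sub, mul_sub, sub_mul, mul_assoc]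

/-- Comparison of two Heisenberg evolutions of `A`. If `h` is the part of both Hamiltonians that
does not commute with `A`, then the difference is controlled by the difference of the evolutions
of `h`. -/
lemma norm_heisenberg_sub_le {H H' h A : 𝔸} (hH : IsSelfAdjoint H) (hH' : IsSelfAdjoint H')
    (hh : IsSelfAdjoint h) (hA : Commute A (H - h)) (hA' : Commute A (H' - h)) {B B' : ℝ → ℝ}
    (hB : ∀ s, HasDerivAt B (B' s) s) (hB0 : 0 ≤ B 0) {t : ℝ} (ht : 0 ≤ t)
    (hle : ∀ s, 0 ≤ s → ‖heisenberg H s h - heisenberg H' s h‖ ≤ B' s) :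
    ‖heisenberg H t A - heisenberg H' t A‖ ≤ 2 * ‖A‖ * B t := by
  set V : 𝔸 := propagator H t * propagator (H - h) (-t) with hV
  set V' : 𝔸 := propagator H' t * propagator (H' - h) (-t) with hV'
  have hVu : V ∈ unitary 𝔸 :=
    mul_mem (propagator_mem_unitary hH _) (propagator_mem_unitary (hH.sub hh) _)
  have hV'u : V' ∈ unitary 𝔸 :=
    mul_mem (propagator_mem_unitary hH' _) (propagator_mem_unitary (hH'.sub hh) _)
  have hVs : star V = propagator (H - h) t * propagator H (-t) := by
    rw [hV, star_mul, star_propagator hH, star_propagator (hH.sub hh), neg_neg]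
  have hV's : star V' = propagator (H' - h) t * propagator H' (-t) := by
    rw [hV', star_mul, star_propagator hH', star_propagator (hH'.sub hh), neg_neg]
  -- `V` and `V'` implement the evolution on `A`, since `A` commutes with `H - h` and `H' - h`.
  have hVA : heisenberg H t A = V * A * star V := by
    rw [hVs, hV, mul_assoc (propagator H t), ← (commute_propagator_right hA (-t)).eq]
    calc _ = propagator H t * A * 1 * propagator H (-t) := by rw [heisenberg, mul_one]
      _ = _ := by
        rw [← propagator_neg_mul (H - h) t]
        simp only [mul_assoc]
  have hV'A : heisenberg H' t A = V' * A * star V' := by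
    rw [hV's, hV', mul_assoc (propagator H' t), ← (commute_propagator_right hA' (-t)).eq]
    calc _ = propagator H' t * A * 1 * propagator H' (-t) := by rw [heisenberg, mul_one]
      _ = _ := by
        rw [← propagator_neg_mul (H' - h) t]
        simp only [mul_assoc]
  have hW : ‖star V' * V - 1‖ ≤ B t := by
    have hder : ∀ s : ℝ, HasDerivAt
        (fun s => (propagator (H' - h) s * propagator H' (-s)) *
          (propagator H s * propagator (H - h) (-s)) - 1) _ s :=
      fun s => (hasDerivAt_interaction H H' h s).sub_const 1
    have := image_norm_le_of_norm_deriv_right_le_deriv_boundary (a := 0) (b := t)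
      (fun s _ => (hder s).continuousAt.continuousWithinAt)
      (fun s _ => (hder s).hasDerivWithinAt) (B := B) (B' := B')
      (by simpa [propagator_zero] using hB0) hB
      (fun s hs => by
        rw [CStarRing.norm_mul_mem_unitary _ (mul_mem (propagator_mem_unitary hH _)
            (propagator_mem_unitary (hH.sub hh) _)),
          CStarRing.norm_mem_unitary_mul _ (mul_mem (propagator_mem_unitary (hH'.sub hh) _)
            (propagator_mem_unitary hH' _)), norm_smul, Complex.norm_I, one_mul]
        exact hle s hs.1)
      (Set.right_mem_Icc.2 ht)
    rw [hV's]
    exact this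
  have hkey : V * A * star V - V' * A * star V' =
      V' * ((star V' * V - 1) * A - A * (star V' * V - 1)) * star V := by
    have e1 := (Unitary.mem_iff.1 hVu).2
    have e2 := (Unitary.mem_iff.1 hV'u).2
    calc V * A * star V - V' * A * star V'
        = (V' * star V') * V * A * star V - V' * A * star V' * (V * star V) := by
          rw [e1, e2, one_mul, mul_one]
      _ = _ := by noncomm_ring
  rw [hVA, hV'A, hkey, CStarRing.norm_mul_mem_unitary _ (Unitary.star_mem hVu),
    CStarRing.norm_mem_unitary_mul _ hV'u]
  calc _ ≤ ‖star V' * V - 1‖ * ‖A‖ + ‖A‖ * ‖star V' * V - 1‖ :=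
        (norm_sub_le _ _).trans (add_le_add (norm_mul_le _ _) (norm_mul_le _ _))
    _ = 2 * ‖A‖ * ‖star V' * V - 1‖ := by ring
    _ ≤ 2 * ‖A‖ * B t := by gcongr

end Dynamics

/-! ### Operators supported on a region -/

section Support

open Matrix Kronecker

variable {Γ : Type} [Fintype Γ] [DecidableEq Γ] {q : Γ → ℕ}

/-- A configuration is a configuration inside `X` together with one outside `X`. -/
abbrev splitConfig (X : Finset Γ) :
    Config q ≃ RegionConfig q X × ((i : {i // ¬ i ∈ X}) → Fin (q i)) :=
  Equiv.piEquivPiSubtypeProd (fun i => i ∈ X) fun i => Fin (q i)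

/-- The embedding `a ↦ a ⊗ 1` of the operators on the region `X` into all operators. -/
noncomputable def regionEmbedding (X : Finset Γ) :
    Matrix (RegionConfig q X) (RegionConfig q X) ℂ →ₐ[ℂ] Op q where
  toFun a := (a ⊗ₖ (1 : Matrix ((i : {i // ¬ i ∈ X}) → Fin (q i)) _ ℂ)).submatrix
    (splitConfig X) (splitConfig X)
  map_one' := by simp
  map_mul' a b := by
    rw [submatrix_mul_equiv, ← mul_kronecker_mul, one_mul]
  map_zero' := by simp
  map_add' a b := by
    rw [add_kronecker]
    rfl
  commutes' r := by
    rw [Algebra.algebraMap_eq_smul_one, Algebra.algebraMap_eq_smul_one, smul_kronecker,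
      one_kronecker_one, ← submatrix_one_equiv (splitConfig X)]
    rfl

lemma supportedOn_iff {X : Finset Γ} {A : Op q} :
    SupportedOn X A ↔ ∃ a, A = regionEmbedding X a := by
  refine exists_congr fun a => ?_
  rw [← Matrix.ext_iff]
  refine forall₂_congr fun s s' => ?_
  have : (∀ i, i ∉ X → s i = s' i) ↔
      ((fun i : {i // ¬ i ∈ X} => s i) = fun i : {i // ¬ i ∈ X} => s' i) := by
    simp [funext_iff]
  simp [regionEmbedding, kroneckerMap_apply, one_apply, this]

lemma SupportedOn.mono {X Y : Finset Γ} (hXY : X ⊆ Y) {A : Op q} (hA : SupportedOn X A) :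
    SupportedOn Y A := by
  obtain ⟨a, ha⟩ := hA
  refine ⟨fun y y' => if ∀ i : Y, (i : Γ) ∉ X → y i = y' i then
    a (fun i => y ⟨i, hXY i.2⟩) (fun i => y' ⟨i, hXY i.2⟩) else 0, fun s s' => ?_⟩
  rw [ha, ← ite_and]
  refine if_congr ⟨fun h => ⟨fun i hi => h i fun hX => hi (hXY hX), fun i hi => h i hi⟩,
    fun h i hi => ?_⟩ rfl rfl
  by_cases hY : i ∈ Y
  · exact h.2 ⟨i, hY⟩ hi
  · exact h.1 i hY

lemma SupportedOn.one (X : Finset Γ) : SupportedOn X (1 : Op q) :=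
  supportedOn_iff.2 ⟨1, (map_one _).symm⟩

lemma SupportedOn.mul {X : Finset Γ} {A B : Op q} (hA : SupportedOn X A) (hB : SupportedOn X B) :
    SupportedOn X (A * B) := by
  rw [supportedOn_iff] at *
  obtain ⟨a, rfl⟩ := hA
  obtain ⟨b, rfl⟩ := hB
  exact ⟨a * b, (map_mul _ _ _).symm⟩

lemma SupportedOn.sum {ι : Type*} {s : Finset ι} {X : Finset Γ} {A : ι → Op q}
    (hA : ∀ i ∈ s, SupportedOn X (A i)) : SupportedOn X (∑ i ∈ s, A i) := by
  simp only [supportedOn_iff] at *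
  choose! a ha using hA
  exact ⟨∑ i ∈ s, a i, by rw [map_sum]; exact Finset.sum_congr rfl ha⟩

lemma SupportedOn.propagator {X : Finset Γ} {H : Op q} (hH : SupportedOn X H) (t : ℝ) :
    SupportedOn X (propagator H t) := by
  rw [supportedOn_iff] at *
  obtain ⟨a, rfl⟩ := hH
  refine ⟨NormedSpace.exp (t • (Complex.I • a)), ?_⟩
  let _ : NormedAlgebra ℚ (Matrix (RegionConfig q X) (RegionConfig q X) ℂ) :=
    NormedAlgebra.restrictScalars ℚ ℂ _
  have hc : Continuous (regionEmbedding (q := q) X) :=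
    (regionEmbedding (q := q) X).toLinearMap.continuous_of_finiteDimensional
  rw [NormedSpace.map_exp _ hc]
  rw [LiebRobinson.propagator, ← Complex.coe_smul, ← Complex.coe_smul t (Complex.I • a), map_smul,
    map_smul]

lemma SupportedOn.heisenberg {X : Finset Γ} {H A : Op q} (hH : SupportedOn X H)
    (hA : SupportedOn X A) (t : ℝ) : SupportedOn X (heisenberg H t A) :=
  ((hH.propagator t).mul hA).mul (hH.propagator (-t))

/-- Operators supported outside `X` are of the form `1 ⊗ b`. -/
lemma SupportedOn.exists_eq_of_compl {X : Finset Γ} {B : Op q} (hB : SupportedOn Xᶜ B) :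
    ∃ b : Matrix ((i : {i // ¬ i ∈ X}) → Fin (q i)) ((i : {i // ¬ i ∈ X}) → Fin (q i)) ℂ,
      B = ((1 : Matrix (RegionConfig q X) (RegionConfig q X) ℂ) ⊗ₖ b).submatrix
        (splitConfig X) (splitConfig X) := by
  obtain ⟨b, hb⟩ := hB
  refine ⟨fun x x' => b (fun i => x ⟨i, Finset.mem_compl.1 i.2⟩)
    fun i => x' ⟨i, Finset.mem_compl.1 i.2⟩, ?_⟩
  ext s s'
  have : (∀ i, i ∉ Xᶜ → s i = s' i) ↔ ((fun i : X => s i) = fun i : X => s' i) := by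
    simp [funext_iff]
  rw [hb]
  change _ = (1 : Matrix _ _ ℂ) (fun i : X => s i) (fun i : X => s' i) *
    b (fun i => s i) (fun i => s' i)
  rw [one_apply, ite_mul, one_mul, zero_mul]
  exact if_congr this rfl rfl

lemma SupportedOn.commute {X Y : Finset Γ} (hXY : Disjoint X Y) {A B : Op q}
    (hA : SupportedOn X A) (hB : SupportedOn Y B) : Commute A B := by
  obtain ⟨a, rfl⟩ := supportedOn_iff.1 hA
  obtain ⟨b, rfl⟩ := (hB.mono (Finset.subset_compl_iff_disjoint_left.2 hXY)).exists_eq_of_compl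
  change _ * _ = _ * _
  simp only [regionEmbedding, AlgHom.coe_mk, RingHom.coe_mk, MonoidHom.coe_mk, OneHom.coe_mk]
  rw [submatrix_mul_equiv, submatrix_mul_equiv, ← mul_kronecker_mul, ← mul_kronecker_mul]
  simp

lemma expval_eq_sum_split (X : Finset Γ) (f : RegionConfig q X → ℂ)
    (g : ((i : {i // ¬ i ∈ X}) → Fin (q i)) → ℂ) (ψ : Ket q)
    (hψ : ∀ s, ψ s = f (fun i => s i) * g (fun i => s i))
    (a : Matrix (RegionConfig q X) (RegionConfig q X) ℂ)
    (b : Matrix ((i : {i // ¬ i ∈ X}) → Fin (q i)) ((i : {i // ¬ i ∈ X}) → Fin (q i)) ℂ) :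
    expval ψ ((a ⊗ₖ b).submatrix (splitConfig X) (splitConfig X)) =
      (star f ⬝ᵥ a *ᵥ f) * (star g ⬝ᵥ b *ᵥ g) := by
  have hψ' : ∀ p, ψ ((splitConfig X).symm p) = f p.1 * g p.2 := by
    intro p
    rw [hψ]
    congr 2
    · exact congrArg Prod.fst ((splitConfig X).apply_symm_apply p)
    · exact congrArg Prod.snd ((splitConfig X).apply_symm_apply p)
  simp only [expval, dotProduct, mulVec, submatrix_apply, Pi.star_apply]
  rw [← (splitConfig X).symm.sum_comp]
  simp_rw [← (splitConfig X).symm.sum_comp (fun s => _ * ψ s), hψ', Equiv.apply_symm_apply,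
    kroneckerMap_apply]
  rw [Fintype.sum_prod_type, Finset.sum_mul_sum]
  refine Finset.sum_congr rfl fun x _ => Finset.sum_congr rfl fun y _ => ?_
  rw [Fintype.sum_prod_type, mul_mul_mul_comm, Finset.sum_mul_sum, star_mul']
  congr 1
  refine Finset.sum_congr rfl fun x' _ => Finset.sum_congr rfl fun y' _ => ?_
  ring

/-- In a product of a vector of the region `X` and a vector of its complement, expectation values
factorize. -/
lemma expval_mul_of_split (X : Finset Γ) (f : RegionConfig q X → ℂ)
    (g : ((i : {i // ¬ i ∈ X}) → Fin (q i)) → ℂ) (ψ : Ket q) (hψ1 : star ψ ⬝ᵥ ψ = 1)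
    (hψ : ∀ s, ψ s = f (fun i => s i) * g (fun i => s i)) {A B : Op q}
    (hA : SupportedOn X A) (hB : SupportedOn Xᶜ B) :
    expval ψ (A * B) = expval ψ A * expval ψ B := by
  obtain ⟨a, rfl⟩ := supportedOn_iff.1 hA
  obtain ⟨b, rfl⟩ := hB.exists_eq_of_compl
  have h1 : (star f ⬝ᵥ f) * (star g ⬝ᵥ g) = 1 := by
    have := expval_eq_sum_split X f g ψ hψ 1 1
    rw [one_kronecker_one, submatrix_one_equiv, expval, one_mulVec, hψ1] at this
    simpa using this.symm
  simp only [regionEmbedding, AlgHom.coe_mk, RingHom.coe_mk, MonoidHom.coe_mk, OneHom.coe_mk]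
  rw [submatrix_mul_equiv, ← mul_kronecker_mul, mul_one, one_mul,
    expval_eq_sum_split X f g ψ hψ, expval_eq_sum_split X f g ψ hψ,
    expval_eq_sum_split X f g ψ hψ, one_mulVec, one_mulVec]
  linear_combination (-(star f ⬝ᵥ a *ᵥ f) * (star g ⬝ᵥ b *ᵥ g)) * h1

end Support

/-! ### Expectation values -/

section Expectation

open Matrix

variable {Γ : Type} [Fintype Γ] [DecidableEq Γ] {q : Γ → ℕ}

lemma norm_expval_le {ψ : Ket q} (hψ : star ψ ⬝ᵥ ψ = 1) (A : Op q) : ‖expval ψ A‖ ≤ ‖A‖ := by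
  have hn : ‖WithLp.toLp 2 ψ‖ = 1 := by
    have h : inner ℂ (WithLp.toLp 2 ψ) (WithLp.toLp 2 ψ) = (1 : ℂ) := by
      rw [EuclideanSpace.inner_eq_star_dotProduct, dotProduct_comm]
      exact hψ
    rw [inner_self_eq_norm_sq_to_K] at h
    have h2 : ‖WithLp.toLp 2 ψ‖ ^ 2 = 1 := by
      apply Complex.ofReal_injective
      simpa using h
    nlinarith [norm_nonneg (WithLp.toLp 2 ψ)]
  have he : expval ψ A = inner ℂ (WithLp.toLp 2 ψ) (WithLp.toLp 2 (A *ᵥ ψ)) := by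
    rw [EuclideanSpace.inner_eq_star_dotProduct, dotProduct_comm]
    rfl
  rw [he]
  refine (norm_inner_le_norm _ _).trans ?_
  have := l2_opNorm_mulVec A (WithLp.toLp 2 ψ)
  rw [hn, mul_one] at this
  rw [hn, one_mul]
  exact this

lemma expval_sub (ψ : Ket q) (A B : Op q) : expval ψ (A - B) = expval ψ A - expval ψ B := by
  simp [expval, sub_mulVec, dotProduct_sub]

lemma expval_one {ψ : Ket q} (hψ : star ψ ⬝ᵥ ψ = 1) : expval ψ 1 = 1 := by
  rw [expval, one_mulVec, hψ]

lemma evolve_eq (H : Op q) (t : ℝ) (ψ : Ket q) : evolve H t ψ = propagator H (-t) *ᵥ ψ := by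
  rw [evolve, propagator]
  congr 2
  rw [← Complex.coe_smul, smul_smul]
  congr 1
  push_cast
  ring_nf

lemma expval_evolve {H : Op q} (hH : H.IsHermitian) (t : ℝ) (ψ : Ket q) (A : Op q) :
    expval (evolve H t ψ) A = expval ψ (heisenberg H t A) := by
  have hs : (propagator H (-t))ᴴ = propagator H t := by
    have := star_propagator (H := H) hH (-t)
    rwa [neg_neg] at this
  rw [evolve_eq, expval, expval, star_mulVec, hs, ← dotProduct_mulVec, mulVec_mulVec, mulVec_mulVec,
    heisenberg]

lemma evolve_normalized {H : Op q} (hH : H.IsHermitian) (t : ℝ) {ψ : Ket q}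
    (hψ : star ψ ⬝ᵥ ψ = 1) : star (evolve H t ψ) ⬝ᵥ evolve H t ψ = 1 := by
  have h := expval_evolve hH t ψ 1
  rwa [expval, one_mulVec, heisenberg, mul_one, propagator_mul_neg, expval_one hψ] at h

end Expectation

/-! ### Locality of the dynamics -/

section ShortRange

variable {Γ : Type} [Fintype Γ] [DecidableEq Γ] {q : Γ → ℕ}

/-- The part of the Hamiltonian consisting of the terms inside the region `S`. -/
noncomputable def localHamiltonian (h : Sym2 Γ → Op q) (S : Finset Γ) : Op q :=
  ∑ e with ∀ i ∈ e, i ∈ S, h e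

/-- The part of the Hamiltonian consisting of the terms acting on some site of `Z`. -/
noncomputable def touchingHamiltonian (h : Sym2 Γ → Op q) (Z : Finset Γ) : Op q :=
  ∑ e with ∃ i ∈ e, i ∈ Z, h e

lemma localHamiltonian_univ (h : Sym2 Γ → Op q) :
    localHamiltonian h Finset.univ = hamiltonian h := by
  simp [localHamiltonian, hamiltonian]

variable [MetricSpace Γ] {ℓ J : ℝ} {D : ℕ} {h : Sym2 Γ → Op q}

lemma IsShortRange.mono (hh : IsShortRange ℓ J D h) {ℓ' J' : ℝ} (hℓ : ℓ ≤ ℓ') (hJ : J ≤ J') :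
    IsShortRange ℓ' J' D h where
  hermitian := hh.hermitian
  supported := hh.supported
  norm_le e := (hh.norm_le e).trans hJ
  range i j hij := hh.range i j (hℓ.trans_lt hij)
  coordination := hh.coordination

lemma IsShortRange.isSelfAdjoint_sum (hh : IsShortRange ℓ J D h) (s : Finset (Sym2 Γ)) :
    IsSelfAdjoint (∑ e ∈ s, h e) :=
  (selfAdjoint (Op q)).sum_mem fun e _ => hh.hermitian e

lemma IsShortRange.isHermitian_hamiltonian (hh : IsShortRange ℓ J D h) :
    (hamiltonian h).IsHermitian :=
  hh.isSelfAdjoint_sum Finset.univ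

lemma IsShortRange.supportedOn_localHamiltonian (hh : IsShortRange ℓ J D h) (S : Finset Γ) :
    SupportedOn S (localHamiltonian h S) := by
  refine SupportedOn.sum fun e he => ?_
  have he' := (Finset.mem_filter.1 he).2
  induction e with
  | h i j =>
    refine (hh.supported i j).mono fun a ha => ?_
    rcases Finset.mem_insert.1 ha with rfl | ha
    · exact he' _ (Sym2.mem_mk_left _ _)
    · rw [Finset.mem_singleton.1 ha]
      exact he' _ (Sym2.mem_mk_right _ _)

/-- Up to terms that commute with the operators on `Z`, the Hamiltonian of a region which contains
all terms acting on `Z` is the sum of these terms. -/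
lemma IsShortRange.commute_localHamiltonian_sub (hh : IsShortRange ℓ J D h) {Z S : Finset Γ}
    (hZS : ∀ i ∈ Z, ∀ j, dist i j ≤ ℓ → i ∈ S ∧ j ∈ S) {A : Op q} (hA : SupportedOn Z A) :
    Commute A (localHamiltonian h S - touchingHamiltonian h Z) := by
  rw [localHamiltonian, touchingHamiltonian, Finset.sum_filter, Finset.sum_filter,
    ← Finset.sum_sub_distrib]
  refine Commute.sum_right _ _ _ fun e _ => ?_
  by_cases he : ∃ i ∈ e, i ∈ Z
  · obtain ⟨i, hie, hiZ⟩ := he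
    obtain ⟨j, rfl⟩ := Sym2.mem_iff_exists.1 hie
    have htouch : ∃ a ∈ s(i, j), a ∈ Z := ⟨i, hie, hiZ⟩
    rw [if_pos htouch]
    rcases le_or_gt (dist i j) ℓ with hij | hij
    · have := hZS i hiZ j hij
      rw [if_pos (by simpa using this), sub_self]
      exact Commute.zero_right _
    · rw [hh.range i j hij]
      simp
  · rw [if_neg he, sub_zero]
    split_ifs
    · induction e with
      | h i j =>
        refine hA.commute ?_ (hh.supported i j)
        rw [Finset.disjoint_left]
        intro a haZ ha
        apply he
        rcases Finset.mem_insert.1 ha with rfl | ha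
        · exact ⟨_, Sym2.mem_mk_left _ _, haZ⟩
        · rw [Finset.mem_singleton.1 ha] at haZ
          exact ⟨_, Sym2.mem_mk_right _ _, haZ⟩
    · exact Commute.zero_right _

/-- At most `D + 1` nonzero terms act on a given site: `D` pairs and the on-site term. -/
lemma IsShortRange.card_touching_le (hh : IsShortRange ℓ J D h) (Z : Finset Γ) :
    (Finset.univ.filter fun e : Sym2 Γ => (∃ i ∈ e, i ∈ Z) ∧ h e ≠ 0).card ≤
      Z.card * (D + 1) := by
  classical
  have hsub : (Finset.univ.filter fun e : Sym2 Γ => (∃ i ∈ e, i ∈ Z) ∧ h e ≠ 0) ⊆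
      Z.biUnion fun i => (insert i (Finset.univ.filter fun j => j ≠ i ∧ h s(i, j) ≠ 0)).image
        fun j => s(i, j) := by
    intro e he
    obtain ⟨⟨i, hie, hiZ⟩, hne⟩ := (Finset.mem_filter.1 he).2
    obtain ⟨j, rfl⟩ := Sym2.mem_iff_exists.1 hie
    refine Finset.mem_biUnion.2 ⟨i, hiZ, Finset.mem_image.2 ⟨j, ?_, rfl⟩⟩
    by_cases hji : j = i
    · rw [hji]
      exact Finset.mem_insert_self _ _
    · exact Finset.mem_insert_of_mem (by simp [hji, hne])
  refine (Finset.card_le_card hsub).trans (Finset.card_biUnion_le_card_mul _ _ _ fun i _ => ?_)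
  refine Finset.card_image_le.trans ((Finset.card_insert_le _ _).trans ?_)
  have := hh.coordination i
  rw [Set.ncard_eq_toFinset_card'] at this
  refine Nat.succ_le_succ (le_trans (le_of_eq ?_) this)
  congr 1
  ext j
  simp

/-- Locality of the dynamics: if the region `S` contains the ball of radius `k ℓ` around `Z`, then
the terms of the Hamiltonian outside of `S` influence an observable on `Z` only by an amount that
is exponentially small in `k`. Each step of the induction passes from `Z` to the pairs of
sites that interact with `Z`, which costs a distance `ℓ`. -/
lemma IsShortRange.norm_heisenberg_sub_local_le (hh : IsShortRange ℓ J D h) (hJ : 0 < J)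
    (lam : ℝ) (S : Finset Γ) (k : ℕ) :
    ∀ (Z : Finset Γ), Z.Nonempty → (∀ i ∈ Z, i ∈ S) →
      (∀ i ∈ Z, ∀ j, dist i j ≤ k * ℓ → j ∈ S) →
      ∀ A : Op q, SupportedOn Z A → ∀ t : ℝ, 0 ≤ t →
      ‖heisenberg (hamiltonian h) t A - heisenberg (localHamiltonian h S) t A‖ ≤
        2 * Z.card * ‖A‖ * Real.exp (4 * (D + 1) * J * Real.exp lam * t - lam * k) := by
  set v : ℝ := 4 * (D + 1) * J * Real.exp lam with hv
  have hvpos : 0 < v := by positivity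
  have hHsa : IsSelfAdjoint (hamiltonian h) := hh.isHermitian_hamiltonian
  have hSsa : IsSelfAdjoint (localHamiltonian h S) := hh.isSelfAdjoint_sum _
  induction k with
  | zero =>
    intro Z hZ _ _ A _ t ht
    have h1 : (1 : ℝ) ≤ Z.card := by exact_mod_cast Finset.card_pos.2 hZ
    have h2 : 1 ≤ Real.exp (v * t - lam * (0 : ℕ)) := by
      rw [Real.one_le_exp_iff]
      simpa using mul_nonneg hvpos.le ht
    calc _ ≤ ‖A‖ + ‖A‖ := by
          refine (norm_sub_le _ _).trans ?_
          rw [norm_heisenberg hHsa, norm_heisenberg hSsa]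
      _ = 2 * 1 * ‖A‖ * 1 := by ring
      _ ≤ _ := by gcongr
  | succ k ih =>
    intro Z _ hZS hcone A hA t ht
    have hball : ∀ i ∈ Z, ∀ j, dist i j ≤ ℓ → i ∈ S ∧ ∀ a, dist j a ≤ k * ℓ → a ∈ S := by
      refine fun i hi j hij => ⟨hZS i hi, fun a ha => hcone i hi a ?_⟩
      have := dist_triangle i j a
      push_cast
      linarith
    have hball' : ∀ i ∈ Z, ∀ j, dist i j ≤ ℓ → i ∈ S ∧ j ∈ S := by
      refine fun i hi j hij => ⟨hZS i hi, hcone i hi j ?_⟩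
      have : 0 ≤ ℓ := dist_nonneg.trans hij
      push_cast
      nlinarith [mul_nonneg (Nat.cast_nonneg (α := ℝ) k) this]
    -- At most `|Z| (D + 1)` terms touch `Z`, and the induction hypothesis bounds the contribution
    -- of each by `4 * J * exp (v * s - lam * k)`. Integrating over time divides by `v`, which is
    -- chosen such that this gains the factor `exp (-lam)`.
    set c : ℝ := Z.card * (D + 1) * (4 * J) * Real.exp (-(lam * k)) with hc
    have hB : ∀ s, HasDerivAt (fun s => c * Real.exp (v * s) / v) (c * Real.exp (v * s)) s := by
      intro s
      have h1 : HasDerivAt (fun s => v * s) v s := by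
        simpa using (hasDerivAt_id s).const_mul v
      refine ((h1.exp.const_mul c).div_const v).congr_deriv ?_
      field_simp
    have hmain := norm_heisenberg_sub_le hHsa hSsa
      (h := touchingHamiltonian h Z) (hh.isSelfAdjoint_sum _)
      (by
        rw [← localHamiltonian_univ]
        exact hh.commute_localHamiltonian_sub (by simp) hA)
      (hh.commute_localHamiltonian_sub hball' hA) hB (by positivity) ht ?_
    · refine hmain.trans (le_of_eq ?_)
      have hexp : Real.exp (v * t - lam * ((k + 1 : ℕ) : ℝ)) =
          Real.exp (-(lam * k)) * Real.exp (v * t) * (Real.exp lam)⁻¹ := by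
        rw [← Real.exp_add, ← Real.exp_neg, ← Real.exp_add]
        congr 1
        push_cast
        ring
      rw [hexp, hc, hv]
      field_simp
    · intro s hs
      have hterm : ∀ e : Sym2 Γ, (∃ i ∈ e, i ∈ Z) → h e ≠ 0 →
          ‖heisenberg (hamiltonian h) s (h e) - heisenberg (localHamiltonian h S) s (h e)‖ ≤
            4 * J * Real.exp (v * s - lam * k) := by
        rintro e ⟨i, hie, hiZ⟩ hne
        obtain ⟨j, rfl⟩ := Sym2.mem_iff_exists.1 hie
        have hij : dist i j ≤ ℓ := not_lt.1 fun hlt => hne (hh.range i j hlt)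
        have h0 : 0 ≤ ℓ := dist_nonneg.trans hij
        refine (ih {i, j} (by simp) ?_ ?_ _ (hh.supported i j) s hs).trans ?_
        · intro a ha
          rcases Finset.mem_insert.1 ha with rfl | ha
          · exact hZS _ hiZ
          · rw [Finset.mem_singleton.1 ha]
            exact (hball' i hiZ j hij).2
        · intro a ha
          rcases Finset.mem_insert.1 ha with rfl | ha
          · exact (hball a hiZ a (by simpa using h0)).2
          · rw [Finset.mem_singleton.1 ha]
            exact (hball i hiZ j hij).2
        · have h2 : ((({i, j} : Finset Γ).card : ℕ) : ℝ) ≤ 2 := by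
            exact_mod_cast Finset.card_le_two
          calc _ ≤ 2 * 2 * J * Real.exp (v * s - lam * k) := by
                gcongr
                exact hh.norm_le _
            _ = _ := by ring
      rw [touchingHamiltonian, heisenberg_sum, heisenberg_sum, ← Finset.sum_sub_distrib]
      rw [← Finset.sum_filter_of_ne (p := fun e => h e ≠ 0) (fun e _ hne h0 => hne (by
        simp [h0, heisenberg])), Finset.filter_filter]
      refine (norm_sum_le _ _).trans ((Finset.sum_le_card_nsmul _ _
        (4 * J * Real.exp (v * s - lam * k)) fun e he => ?_).trans ?_)
      · have := (Finset.mem_filter.1 he).2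
        exact hterm e this.1 this.2
      · have hcard : ((Finset.univ.filter fun e : Sym2 Γ => (∃ i ∈ e, i ∈ Z) ∧ h e ≠ 0).card : ℝ) ≤
            Z.card * (D + 1) := by
          exact_mod_cast hh.card_touching_le Z
        rw [nsmul_eq_mul]
        calc _ ≤ (Z.card * (D + 1) : ℝ) * (4 * J * Real.exp (v * s - lam * k)) := by gcongr
          _ = _ := by
            rw [hc, sub_eq_neg_add, Real.exp_add]
            ring

end ShortRange

/-! ### Product states -/

section ProductState

variable {Γ : Type} [Fintype Γ] [DecidableEq Γ] {q : Γ → ℕ}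

/-- A product state with respect to `X` and `Y` is a product of a vector of `S` and a vector of
its complement for every region `S` which contains `X` and does not meet `Y`. -/
lemma IsProductState.exists_split {X Y S : Finset Γ} {ψ : Ket q} (hψ : IsProductState ![X, Y] ψ)
    (hX : X ⊆ S) (hY : Y ⊆ Sᶜ) :
    ∃ (f : RegionConfig q S → ℂ) (g : ((i : {i // ¬ i ∈ S}) → Fin (q i)) → ℂ),
      ∀ s, ψ s = f (fun i => s i) * g (fun i => s i) := by
  obtain ⟨-, φ, χ, hφ⟩ := hψ
  let W : Finset Γ := (Finset.univ.biUnion ![X, Y])ᶜ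
  refine ⟨fun x => φ 0 (fun i => x ⟨i, hX i.2⟩) *
      ∏ i : {i // i ∈ S}, if (i : Γ) ∈ W then χ i (x i) else 1,
    fun y => φ 1 (fun i => y ⟨i, Finset.mem_compl.1 (hY i.2)⟩) *
      ∏ i : {i // ¬ i ∈ S}, if (i : Γ) ∈ W then χ i (y i) else 1, fun s => ?_⟩
  have hW : ∏ i ∈ W, χ i (s i) = (∏ i : {i // i ∈ S}, if (i : Γ) ∈ W then χ i (s i) else 1) *
      ∏ i : {i // ¬ i ∈ S}, if (i : Γ) ∈ W then χ i (s i) else 1 := by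
    have hsplit := Fintype.prod_subtype_mul_prod_subtype (fun i => i ∈ S)
      fun i => if i ∈ W then χ i (s i) else 1
    have hfilter : ∏ i ∈ W, χ i (s i) = ∏ i, if i ∈ W then χ i (s i) else 1 := by
      rw [← Finset.prod_filter, Finset.filter_mem_eq_inter, Finset.univ_inter]
    rw [hfilter, ← hsplit]
    congr!
  rw [hφ, Fin.prod_univ_two]
  change _ * ∏ i ∈ W, χ i (s i) = _
  rw [hW]
  exact mul_mul_mul_comm _ _ _ _

end ProductState

/-! ### The bipartite bound -/

section Bipartite

variable {Γ : Type}

lemma setDist_le_dist [MetricSpace Γ] {X Y : Finset Γ} {x y : Γ} (hx : x ∈ X) (hy : y ∈ Y) :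
    setDist X Y ≤ dist x y :=
  csInf_le ⟨0, by rintro _ ⟨x, _, y, _, rfl⟩; exact dist_nonneg⟩ ⟨x, hx, y, hy, rfl⟩

lemma setDist_pos [Fintype Γ] [MetricSpace Γ] {X Y : Finset Γ} (hX : X.Nonempty)
    (hY : Y.Nonempty) (hXY : Disjoint X Y) :
    0 < setDist X Y := by
  obtain ⟨x, hx⟩ := hX
  obtain ⟨y, hy⟩ := hY
  have hfin : {r | ∃ x ∈ X, ∃ y ∈ Y, r = dist x y}.Finite := by
    refine (Set.finite_range fun p : Γ × Γ => dist p.1 p.2).subset ?_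
    rintro _ ⟨x, _, y, _, rfl⟩
    exact ⟨(x, y), rfl⟩
  have hne : {r | ∃ x ∈ X, ∃ y ∈ Y, r = dist x y}.Nonempty := ⟨_, x, hx, y, hy, rfl⟩
  obtain ⟨x', hx', y', hy', he⟩ := hne.csInf_mem hfin
  rw [setDist, he, dist_pos]
  rintro rfl
  exact Finset.disjoint_left.1 hXY hx' hy'

variable [Fintype Γ] [DecidableEq Γ] {q : Γ → ℕ}

lemma norm_connected_le {a b a' b' : Op q} {ψ : Ket q} (hψ : star ψ ⬝ᵥ ψ = 1) (hb : ‖b‖ ≤ 1)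
    (ha' : ‖a'‖ ≤ 1) (hab : expval ψ (a' * b') = expval ψ a' * expval ψ b') :
    ‖connected ψ a b‖ ≤ 2 * (‖a - a'‖ + ‖b - b'‖) := by
  have e : connected ψ a b = expval ψ ((a - a') * b + a' * (b - b')) -
      (expval ψ (a - a') * expval ψ b + expval ψ a' * expval ψ (b - b')) := by
    have : (a - a') * b + a' * (b - b') = a * b - a' * b' := by noncomm_ring
    rw [this, expval_sub, expval_sub, expval_sub, hab, connected]
    ring
  have h1 : ‖expval ψ ((a - a') * b + a' * (b - b'))‖ ≤ ‖a - a'‖ + ‖b - b'‖ := by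
    refine (norm_expval_le hψ _).trans ((norm_add_le _ _).trans ?_)
    refine add_le_add ((norm_mul_le _ _).trans ?_) ((norm_mul_le _ _).trans ?_)
    · exact mul_le_of_le_one_right (norm_nonneg _) hb
    · exact mul_le_of_le_one_left (norm_nonneg _) ha'
  have h2 : ‖expval ψ (a - a') * expval ψ b + expval ψ a' * expval ψ (b - b')‖ ≤
      ‖a - a'‖ + ‖b - b'‖ := by
    refine (norm_add_le _ _).trans ?_
    rw [norm_mul, norm_mul]
    refine add_le_add ?_ ?_
    · exact (mul_le_of_le_one_right (norm_nonneg _) ((norm_expval_le hψ _).trans hb)).trans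
        (norm_expval_le hψ _)
    · exact (mul_le_of_le_one_left (norm_nonneg _) ((norm_expval_le hψ _).trans ha')).trans
        (norm_expval_le hψ _)
  rw [e]
  refine (norm_sub_le _ _).trans ?_
  linarith

/-- The bipartite Lieb-Robinson bound, by comparison with the evolutions generated by the terms
inside a neighbourhood of `X` and inside its complement. -/
theorem IsShortRange.bipartiteBound [MetricSpace Γ] {ℓ J : ℝ} {D : ℕ} {h : Sym2 Γ → Op q}
    (hh : IsShortRange ℓ J D h) (hℓ : 0 < ℓ) (hJ : 0 < J) :
    BipartiteBound h (fun m => 4 * Real.exp (2 * ℓ) * (m : ℝ))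
      (4 * (D + 1) * J * Real.exp (2 * ℓ)) := by
  intro X Y hX hY hXY ψ hψ A B hA hB t ht
  set v : ℝ := 4 * (D + 1) * J * Real.exp (2 * ℓ) with hv
  -- The number `k` of interaction ranges that fit into half of the distance.
  obtain ⟨k, hk1, hk2⟩ : ∃ k : ℕ, 2 * (k * ℓ) < setDist X Y ∧
      setDist X Y ≤ 2 * ℓ * k + 2 * ℓ := by
    have hd : 0 < setDist X Y / (2 * ℓ) := div_pos (setDist_pos hX hY hXY) (by linarith)
    obtain ⟨k, hk⟩ := Nat.exists_eq_succ_of_ne_zero (Nat.ceil_pos.2 hd).ne'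
    refine ⟨k, ?_, ?_⟩
    · have h1 := Nat.ceil_lt_add_one hd.le
      rw [hk, Nat.cast_succ] at h1
      have h2 : (k : ℝ) < setDist X Y / (2 * ℓ) := by linarith
      rw [lt_div_iff₀ (by linarith)] at h2
      linarith
    · have h1 := Nat.le_ceil (setDist X Y / (2 * ℓ))
      rw [hk, Nat.cast_succ, div_le_iff₀ (by linarith)] at h1
      linarith
  have hkl : 0 ≤ k * ℓ := by positivity
  set S : Finset Γ := Finset.univ.filter fun j => ∃ i ∈ X, dist i j ≤ k * ℓ with hS
  have hXS : ∀ i ∈ X, ∀ j, dist i j ≤ k * ℓ → j ∈ S := fun i hi j hij => by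
    simp only [hS, Finset.mem_filter, Finset.mem_univ, true_and]
    exact ⟨i, hi, hij⟩
  have hYS : ∀ i ∈ Y, ∀ j, dist i j ≤ k * ℓ → j ∈ Sᶜ := by
    intro y hy j hyj
    simp only [hS, Finset.mem_compl, Finset.mem_filter, Finset.mem_univ, true_and]
    rintro ⟨x, hx, hxj⟩
    have h1 := dist_triangle_right x y j
    have h2 := setDist_le_dist hx hy
    linarith
  have hXS' : X ⊆ S := fun i hi => hXS i hi i (by simpa using hkl)
  have hYS' : Y ⊆ Sᶜ := fun i hi => hYS i hi i (by simpa using hkl)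
  have hHh := hh.isHermitian_hamiltonian
  have hSsa : IsSelfAdjoint (localHamiltonian h S) := hh.isSelfAdjoint_sum _
  obtain ⟨f, g, hfg⟩ := hψ.exists_split hXS' hYS'
  have hprod := expval_mul_of_split S f g ψ hψ.1 hfg
    ((hh.supportedOn_localHamiltonian S).heisenberg (hA.supported.mono hXS') t)
    ((hh.supportedOn_localHamiltonian Sᶜ).heisenberg (hB.supported.mono hYS') t)
  have hcon : connected (evolve (hamiltonian h) t ψ) A B =
      connected ψ (heisenberg (hamiltonian h) t A) (heisenberg (hamiltonian h) t B) := by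
    simp only [connected, expval_evolve hHh, heisenberg_mul]
  rw [hcon]
  refine (norm_connected_le hψ.1 ((norm_heisenberg hHh t B).trans_le hB.norm_le_one)
    ((norm_heisenberg hSsa t A).trans_le hA.norm_le_one) hprod).trans ?_
  have hloc : ∀ (Z T : Finset Γ) (O : Op q), Z.Nonempty → IsObservable Z O → Z ⊆ T →
      (∀ i ∈ Z, ∀ j, dist i j ≤ k * ℓ → j ∈ T) →
      ‖heisenberg (hamiltonian h) t O - heisenberg (localHamiltonian h T) t O‖ ≤
        2 * Z.card * (Real.exp (2 * ℓ) * Real.exp (v * t - setDist X Y)) := by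
    intro Z T O hZ hO hZT hcone
    refine (hh.norm_heisenberg_sub_local_le hJ (2 * ℓ) T k Z hZ hZT hcone O hO.supported t
      ht).trans ?_
    rw [← Real.exp_add]
    calc _ ≤ 2 * (Z.card : ℝ) * 1 * Real.exp (2 * ℓ + (v * t - setDist X Y)) := by
          gcongr
          · exact hO.norm_le_one
          · linarith
      _ = _ := by ring
  have h1 := hloc X S A hX hA hXS' hXS
  have h2 := hloc Y Sᶜ B hY hB hYS' hYS
  push_cast
  linarith

end Bipartite

/-! ### The multipartite bound -/

section Multipartite

variable {Γ : Type} [DecidableEq Γ] {n : ℕ}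

lemma exists_criticalDist_eq [MetricSpace Γ] (hn : 2 ≤ n) (X : Fin n → Finset Γ) :
    ∃ I : Finset (Fin n), I.Nonempty ∧ Iᶜ.Nonempty ∧
      criticalDist X = setDist (I.biUnion X) (Iᶜ.biUnion X) := by
  refine Set.Nonempty.csSup_mem (s := {r | ∃ I : Finset (Fin n), I.Nonempty ∧ Iᶜ.Nonempty ∧
      r = setDist (I.biUnion X) (Iᶜ.biUnion X)}) ?_ ?_
  · refine ⟨_, {⟨0, by omega⟩}, Finset.singleton_nonempty _, ⟨⟨1, by omega⟩, ?_⟩, rfl⟩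
    simp
  · refine (Set.finite_range fun I : Finset (Fin n) =>
      setDist (I.biUnion X) (Iᶜ.biUnion X)).subset ?_
    rintro _ ⟨I, -, -, rfl⟩
    exact ⟨I, rfl⟩

variable [Fintype Γ] {q : Γ → ℕ}

lemma IsObservable.one (X : Finset Γ) : IsObservable X (1 : Op q) where
  hermitian := Matrix.isHermitian_one
  supported := SupportedOn.one X
  norm_le_one := by
    have h : ‖(1 : Op q)‖ * ‖(1 : Op q)‖ = ‖(1 : Op q)‖ := by
      rw [← CStarRing.norm_star_mul_self, star_one, one_mul]
    nlinarith [norm_nonneg (1 : Op q)]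

lemma IsObservable.mono {X Y : Finset Γ} (hXY : X ⊆ Y) {A : Op q} (hA : IsObservable X A) :
    IsObservable Y A :=
  ⟨hA.hermitian, hA.supported.mono hXY, hA.norm_le_one⟩

lemma IsObservable.mul {X : Finset Γ} {A B : Op q} (hA : IsObservable X A) (hB : IsObservable X B)
    (hAB : Commute A B) : IsObservable X (A * B) where
  hermitian := (IsSelfAdjoint.commute_iff (R := Op q) hA.hermitian hB.hermitian).1 hAB
  supported := hA.supported.mul hB.supported
  norm_le_one := (norm_mul_le _ _).trans
    (mul_le_one₀ hA.norm_le_one (norm_nonneg _) hB.norm_le_one)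

lemma pairwise_commute {A : Fin n → Op q} (hA : ∀ k l, Commute (A k) (A l)) (p : Finset (Fin n)) :
    (p : Set (Fin n)).Pairwise (Function.onFun Commute A) :=
  fun k _ l _ _ => hA k l

lemma blockProd_eq_noncommProd (A : Fin n → Op q) (hA : ∀ k l, Commute (A k) (A l))
    (p : Finset (Fin n)) : blockProd A p = p.noncommProd A (pairwise_commute hA p) := by
  have h := p.sort_toFinset (· ≤ ·)
  calc blockProd A p
      = (p.sort (· ≤ ·)).toFinset.noncommProd A (pairwise_commute hA _) :=
        (Finset.noncommProd_toFinset _ _ _ (p.sort_nodup _)).symm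
    _ = _ := Finset.noncommProd_congr h (fun _ _ => rfl) _

lemma blockProd_empty (A : Fin n → Op q) : blockProd A ∅ = 1 := by
  simp [blockProd]

lemma blockProd_eq_mul (A : Fin n → Op q) (hA : ∀ k l, Commute (A k) (A l))
    (I p : Finset (Fin n)) :
    blockProd A p = blockProd A (p ∩ I) * blockProd A (p ∩ Iᶜ) := by
  have hd : Disjoint (p ∩ I) (p ∩ Iᶜ) :=
    disjoint_compl_right.mono Finset.inter_subset_right Finset.inter_subset_right
  have hu : p ∩ I ∪ p ∩ Iᶜ = p := by
    rw [← Finset.inter_union_distrib_left, Finset.union_compl, Finset.inter_univ]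
  rw [blockProd_eq_noncommProd A hA, blockProd_eq_noncommProd A hA, blockProd_eq_noncommProd A hA,
    ← Finset.noncommProd_union_of_disjoint hd A (pairwise_commute hA _)]
  exact Finset.noncommProd_congr hu.symm (fun _ _ => rfl) _

lemma commute_of_isObservable {X : Fin n → Finset Γ} (hX : ∀ k l, k ≠ l → Disjoint (X k) (X l))
    {A : Fin n → Op q} (hA : ∀ k, IsObservable (X k) (A k)) (k l : Fin n) :
    Commute (A k) (A l) := by
  by_cases h : k = l
  · rw [h]
  · exact (hA k).supported.commute (hX k l h) (hA l).supported

lemma isObservable_blockProd {X : Fin n → Finset Γ} {A : Fin n → Op q}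
    (hc : ∀ k l, Commute (A k) (A l)) (hA : ∀ k, IsObservable (X k) (A k)) {p I : Finset (Fin n)}
    (hp : p ⊆ I) : IsObservable (I.biUnion X) (blockProd A p) := by
  induction p using Finset.induction_on with
  | empty =>
    rw [blockProd_empty]
    exact IsObservable.one _
  | insert a s ha ih =>
    have ih' := ih fun i hi => hp (Finset.mem_insert_of_mem hi)
    rw [blockProd_eq_noncommProd A hc] at ih' ⊢
    rw [Finset.noncommProd_insert_of_notMem _ _ _ _ ha]
    have ha' := (hA a).mono (Finset.subset_biUnion_of_mem X (hp (Finset.mem_insert_self _ _)))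
    refine ha'.mul ih' ?_
    exact Finset.noncommProd_commute _ _ _ _ fun l _ => hc a l

/-- A product state with respect to a family of regions is a product state with respect to the
unions of two complementary subfamilies. -/
lemma IsProductState.merge {X : Fin n → Finset Γ} {ψ : Ket q} (hψ : IsProductState X ψ)
    (I : Finset (Fin n)) : IsProductState ![I.biUnion X, Iᶜ.biUnion X] ψ := by
  obtain ⟨h1, φ, χ, hφ⟩ := hψ
  refine ⟨h1, ?_⟩
  have hfam : ![I.biUnion X, Iᶜ.biUnion X] =
      fun m : Fin 2 => (![I, Iᶜ] m).biUnion X := by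
    funext m
    fin_cases m <;> rfl
  rw [hfam]
  have hsub : ∀ (m : Fin 2) (k : {k // k ∈ ![I, Iᶜ] m}), X k ⊆ (![I, Iᶜ] m).biUnion X :=
    fun m k => Finset.subset_biUnion_of_mem X k.2
  refine ⟨fun m x => ∏ k : {k // k ∈ ![I, Iᶜ] m}, φ k fun i => x ⟨i, hsub m k i.2⟩, χ,
    fun s => ?_⟩
  rw [hφ]
  congr 1
  · rw [Fin.prod_univ_two]
    have e : ∀ m : Fin 2, (∏ k : {k // k ∈ ![I, Iᶜ] m}, φ k fun i => s i) =
        ∏ k ∈ ![I, Iᶜ] m, φ k fun i => s i :=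
      fun m => Finset.prod_coe_sort (![I, Iᶜ] m) fun k => φ k fun i => s i
    exact (Finset.prod_mul_prod_compl I _).symm.trans (congrArg₂ (· * ·) (e 0).symm (e 1).symm)
  · congr 2
    ext i
    simp only [Finset.mem_biUnion, Finset.mem_univ, true_and, Fin.exists_fin_two]
    constructor
    · rintro ⟨k, hk⟩
      by_cases hkI : k ∈ I
      · exact Or.inl ⟨k, hkI, hk⟩
      · exact Or.inr ⟨k, Finset.mem_compl.2 hkI, hk⟩
    · rintro (⟨k, -, hk⟩ | ⟨k, -, hk⟩) <;> exact ⟨k, hk⟩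

/-- The multipartite bound. The bipartite bound, applied to a bipartition that realizes the critical
distance, controls how far the expectation values of products are from factorizing. -/
theorem norm_ursell_le [MetricSpace Γ] {h : Sym2 Γ → Op q} (hH : (hamiltonian h).IsHermitian)
    {C₂ : ℕ → ℝ} {v : ℝ} (hbi : BipartiteBound h C₂ v) (hn : 2 ≤ n) {X : Fin n → Finset Γ}
    (hne : ∀ k, (X k).Nonempty) (hX : ∀ k l, k ≠ l → Disjoint (X k) (X l)) {ψ : Ket q}
    (hψ : IsProductState X ψ) {A : Fin n → Op q} (hA : ∀ k, IsObservable (X k) (A k)) {t : ℝ}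
    (ht : 0 ≤ t) :
    ‖ursell (evolve (hamiltonian h) t ψ) A‖ ≤
      (n : ℝ) ^ n / 4 * C₂ (∑ k, (X k).card) * Real.exp (v * t - criticalDist X) := by
  obtain ⟨I, hI, hI', hR⟩ := exists_criticalDist_eq hn X
  have hc := commute_of_isObservable hX hA
  have hψt := evolve_normalized hH t hψ.1
  have hdisj : Disjoint (I.biUnion X) (Iᶜ.biUnion X) := by
    rw [Finset.disjoint_biUnion_left]
    intro k hk
    rw [Finset.disjoint_biUnion_right]
    intro l hl
    refine hX k l ?_
    rintro rfl
    exact Finset.mem_compl.1 hl hk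
  have hcard : (I.biUnion X).card + (Iᶜ.biUnion X).card = ∑ k, (X k).card := by
    rw [Finset.card_biUnion fun k _ l _ hkl => hX k l hkl,
      Finset.card_biUnion fun k _ l _ hkl => hX k l hkl, Finset.sum_add_sum_compl]
  have hε : ∀ s, ‖expval (evolve (hamiltonian h) t ψ) (blockProd A s) -
      expval (evolve (hamiltonian h) t ψ) (blockProd A (s ∩ I)) *
        expval (evolve (hamiltonian h) t ψ) (blockProd A (s ∩ Iᶜ))‖ ≤
      C₂ (∑ k, (X k).card) * Real.exp (v * t - criticalDist X) := by
    intro s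
    have hb := hbi _ _ (hI.biUnion fun k _ => hne k) (hI'.biUnion fun k _ => hne k) hdisj ψ
      (hψ.merge I) _ _ (isObservable_blockProd hc hA (Finset.inter_subset_right (s₁ := s)))
      (isObservable_blockProd hc hA (Finset.inter_subset_right (s₁ := s))) t ht
    rwa [hcard, ← hR, connected, ← blockProd_eq_mul A hc] at hb
  have hmain := norm_cumulant_le I hI hI'
    (fun s => expval (evolve (hamiltonian h) t ψ) (blockProd A s))
    (by rw [blockProd_empty, expval_one hψt])
    (fun s => (norm_expval_le hψt _).trans
      (isObservable_blockProd hc hA (Finset.subset_univ s)).norm_le_one)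
    _ ((norm_nonneg _).trans (hε ∅)) hε
  rw [Fintype.card_fin, ← mul_assoc] at hmain
  exact hmain

end Multipartite

end LiebRobinson

/-- Multipartite Lieb-Robinson bound. The first part says that bipartite Lieb-Robinson constants
exist uniformly over all systems with given interaction range, strength and coordination number;
the second part says that every choice of such constants for a system bounds its `n`-partite
connected correlators. -/
theorem theorem1 (ℓ J : ℝ) (D : ℕ) :
    (∃ C v : ℝ, 0 < C ∧ 0 < v ∧
      ∀ (Γ : Type) [Fintype Γ] [DecidableEq Γ] [MetricSpace Γ] (q : Γ → ℕ)
        (h : Sym2 Γ → LiebRobinson.Op q), LiebRobinson.IsShortRange ℓ J D h →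
        LiebRobinson.BipartiteBound h (fun m => C * (m : ℝ)) v) ∧
    (∀ (Γ : Type) [Fintype Γ] [DecidableEq Γ] [MetricSpace Γ] (q : Γ → ℕ)
      (h : Sym2 Γ → LiebRobinson.Op q), LiebRobinson.IsShortRange ℓ J D h →
      ∀ (C₂ : ℕ → ℝ) (v : ℝ), LiebRobinson.BipartiteBound h C₂ v →
      ∀ (n : ℕ), 2 ≤ n →
      ∀ X : Fin n → Finset Γ, (∀ k, (X k).Nonempty) →
        (∀ k l, k ≠ l → Disjoint (X k) (X l)) →
      ∀ ψ : LiebRobinson.Ket q, LiebRobinson.IsProductState X ψ →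
      ∀ A : Fin n → LiebRobinson.Op q, (∀ k, LiebRobinson.IsObservable (X k) (A k)) →
      ∀ t : ℝ, 0 ≤ t →
        ‖LiebRobinson.ursell (LiebRobinson.evolve (LiebRobinson.hamiltonian h) t ψ) A‖ ≤
          ((n : ℝ) ^ n / 4 * C₂ (∑ k, (X k).card)) *
            Real.exp (v * t - LiebRobinson.criticalDist X)) := by
  refine ⟨⟨4 * Real.exp (2 * max ℓ 1), 4 * (D + 1) * max J 1 * Real.exp (2 * max ℓ 1),
    by positivity, by positivity, ?_⟩, ?_⟩
  · -- The interaction is also short-range for larger constants, so positive ones may be assumed.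
    intro Γ _ _ _ q h hh
    exact (hh.mono (le_max_left ℓ 1) (le_max_left J 1)).bipartiteBound (by positivity)
      (by positivity)
  · intro Γ _ _ _ q h hh C₂ v hbi n hn X hne hX ψ hψ A hA t ht
    exact LiebRobinson.norm_ursell_le hh.isHermitian_hamiltonian hbi hn hne hX hψ hA ht
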